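/- **Setting.** An affine plane is a set $\mathcal P$ of points with a family $\mathcal L$ of subsets of $\mathcal P$, called lines, such that: (1) any two distinct points lie on exactly one line; (2) for every line $\ell$ and point $P\notin\ell$ there is exactly one line through $P$ disjoint from $\ell$; (3) there are three distinct points that lie on no common line. Lines are parallel, $\ell\parallel m$, if $\ell=m$ or $\ell\cap m=\emptyset$. A Desargues affine plane is an affine plane satisfying Desargues' axiom: if $\ell,m,n$ are three distinct lines, $A,A'\in\ell$, $B,B'\in m$, $C,C'\in n$, and the three lines either are mutually parallel or all pass through a point $S$ different from $A,A',B,B',C,C'$, then $AB\parallel A'B'$ and $BC\parallel B'C'$ imply $AC\parallel A'C'$. Let $O\neq I$ be points of a Desargues affine plane and $\ell^{OI}$ the line through them. For $A,B\in\ell^{OI}$ the product $A\cdot B\in\ell^{OI}$ is constructed as follows: choose a point $B_1\notin\ell^{OI}$; let $P_1$ be the intersection of the line $OB_1$ with the parallel to $IB_1$ through $A$; then $A\cdot B$ is the intersection of $\ell^{OI}$ with the parallel to $BB_1$ through $P_1$ (this does not depend on $B_1$). For $B\in \ell^{OI}$, $B\ne O$, let $B^{-1}\in\ell^{OI}$ denote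 the inverse of $B$, i.e. the point with $B^{-1}\cdot B=B\cdot B^{-1}=I$. The ratio of $A,B\in\ell^{OI}$ with $B\neq O$ is the point $r(A:B)=B^{-1}\cdot A$ of $\ell^{OI}$. **Theorem.** Let $B\in\ell^{OI}$ with $B\neq O$. Then $B$ has an inverse, i.e. $B^{-1}\cdot B=B\cdot B^{-1}=I$, and the ratio map $$r_B:\ell^{OI}\to\ell^{OI},\qquad r_B(X)=r(X:B)=B^{-1}\cdot X,$$ is a bijection, whose inverse is the map $R\mapsto B\cdot R$: for all $X,R\in\ell^{OI}$, $B\cdot r_B(X)=X$ and $r_B(B\cdot R)=R$. -/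

import Mathlib

/-- An affine plane on the point set `P`: a family of lines (sets of points) such that two distinct
points lie on exactly one line, Playfair's parallel axiom holds, and there are three distinct
non-collinear points. -/
structure AffinePlane (P : Type*) where
  /-- the lines of the plane -/
  lines : Set (Set P)
  existsUnique_line : ∀ X Y : P, X ≠ Y → ∃! l : Set P, l ∈ lines ∧ X ∈ l ∧ Y ∈ l
  playfair : ∀ (X : P) (l : Set P), l ∈ lines → X ∉ l →
    ∃! m : Set P, m ∈ lines ∧ X ∈ m ∧ l ∩ m = ∅
  exists_triangle : ∃ X Y Z : P, X ≠ Y ∧ Y ≠ Z ∧ X ≠ Z ∧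
    ¬ ∃ l ∈ lines, X ∈ l ∧ Y ∈ l ∧ Z ∈ l

namespace AffinePlane

variable {P : Type*} (𝒜 : AffinePlane P)

/-- Two lines are parallel when they are equal or have no common point. -/
def Parallel (l m : Set P) : Prop := l = m ∨ l ∩ m = ∅

open Classical in
/-- The line through two distinct points `X`, `Y` (by convention `∅` when `X = Y`). -/
noncomputable def join (X Y : P) : Set P :=
  if h : X ≠ Y then (𝒜.existsUnique_line X Y h).choose else ∅

/-- Desargues' axiom, in its parallel and its concurrent form: if the vertices of `ABC` and
`A'B'C'` lie on three distinct lines `l`, `m`, `n` that are parallel, or that pass through a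
common point `S` different from all vertices, and if `AB ∥ A'B'` and `BC ∥ B'C'`, then
`AC ∥ A'C'`. -/
def DesarguesAxiom : Prop :=
  ∀ l ∈ 𝒜.lines, ∀ m ∈ 𝒜.lines, ∀ n ∈ 𝒜.lines, l ≠ m → m ≠ n → l ≠ n →
    ∀ A ∈ l, ∀ A' ∈ l, ∀ B ∈ m, ∀ B' ∈ m, ∀ C ∈ n, ∀ C' ∈ n,
      ((Parallel l m ∧ Parallel m n ∧ Parallel l n) ∨
        ∃ S : P, (S ∈ l ∧ S ∈ m ∧ S ∈ n) ∧
          A ≠ S ∧ A' ≠ S ∧ B ≠ S ∧ B' ≠ S ∧ C ≠ S ∧ C' ≠ S) →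
      Parallel (𝒜.join A B) (𝒜.join A' B') →
      Parallel (𝒜.join B C) (𝒜.join B' C') →
      Parallel (𝒜.join A C) (𝒜.join A' C')

variable {𝒜}

theorem join_spec {X Y : P} (h : X ≠ Y) :
    𝒜.join X Y ∈ 𝒜.lines ∧ X ∈ 𝒜.join X Y ∧ Y ∈ 𝒜.join X Y := by
  rw [join, dif_pos h]
  exact (𝒜.existsUnique_line X Y h).choose_spec.1

theorem line_ext {l m : Set P} (hl : l ∈ 𝒜.lines) (hm : m ∈ 𝒜.lines) {X Y : P} (h : X ≠ Y)
    (hXl : X ∈ l) (hYl : Y ∈ l) (hXm : X ∈ m) (hYm : Y ∈ m) : l = m :=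
  (𝒜.existsUnique_line X Y h).unique ⟨hl, hXl, hYl⟩ ⟨hm, hXm, hYm⟩

theorem join_eq {X Y : P} (h : X ≠ Y) {l : Set P} (hl : l ∈ 𝒜.lines) (hX : X ∈ l) (hY : Y ∈ l) :
    𝒜.join X Y = l :=
  line_ext (join_spec h).1 hl h (join_spec h).2.1 (join_spec h).2.2 hX hY

theorem join_comm (X Y : P) : 𝒜.join X Y = 𝒜.join Y X := by
  by_cases h : X = Y
  · rw [h]
  · exact join_eq h (join_spec (Ne.symm h)).1 (join_spec (Ne.symm h)).2.2 (join_spec (Ne.symm h)).2.1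

theorem Parallel.eq {l m : Set P} (h : Parallel l m) {X : P} (hl : X ∈ l) (hm : X ∈ m) :
    l = m := by
  rcases h with h | h
  · exact h
  · exact absurd (show X ∈ l ∩ m from ⟨hl, hm⟩) (by simp [h])

theorem Parallel.symm {l m : Set P} (h : Parallel l m) : Parallel m l := by
  rcases h with h | h
  · exact Or.inl h.symm
  · exact Or.inr (by rw [Set.inter_comm]; exact h)

theorem existsUnique_parallel {l : Set P} (hl : l ∈ 𝒜.lines) (X : P) :
    ∃! m : Set P, m ∈ 𝒜.lines ∧ X ∈ m ∧ Parallel l m := by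
  by_cases hX : X ∈ l
  · exact ⟨l, ⟨hl, hX, Or.inl rfl⟩, fun m hm => (hm.2.2.eq hX hm.2.1).symm⟩
  · obtain ⟨m, hm, hu⟩ := 𝒜.playfair X l hl hX
    refine ⟨m, ⟨hm.1, hm.2.1, Or.inr hm.2.2⟩, fun k hk => hu k ⟨hk.1, hk.2.1, ?_⟩⟩
    rcases hk.2.2 with h | h
    · exact absurd (h ▸ hk.2.1) hX
    · exact h

theorem Parallel.trans {l m n : Set P} (hl : l ∈ 𝒜.lines) (hm : m ∈ 𝒜.lines) (hn : n ∈ 𝒜.lines)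
    (h₁ : Parallel l m) (h₂ : Parallel m n) : Parallel l n := by
  by_cases h : l ∩ n = ∅
  · exact Or.inr h
  · obtain ⟨X, hXl, hXn⟩ := Set.nonempty_iff_ne_empty.mpr h
    exact Or.inl ((existsUnique_parallel hm X).unique ⟨hl, hXl, h₁.symm⟩ ⟨hn, hXn, h₂⟩)

variable (𝒜)

open Classical in
/-- The line through the point `X` parallel to the line `l` (by convention `∅` when `l` is not a
line). -/
noncomputable def par (l : Set P) (X : P) : Set P :=
  if h : l ∈ 𝒜.lines then (existsUnique_parallel h X).choose else ∅

/-- `C` is obtained from the points `A`, `B` of the line `OI` by the multiplication algorithm with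
auxiliary point `B₁`: the parallel to `IB₁` through `A` meets `OB₁` in `P₁`, and the parallel to
`BB₁` through `P₁` meets `OI` in `C`. -/
def IsProduct (O I B₁ A B C : P) : Prop :=
  ∃ P₁ : P, (P₁ ∈ 𝒜.par (𝒜.join I B₁) A ∧ P₁ ∈ 𝒜.join O B₁) ∧
    (C ∈ 𝒜.par (𝒜.join B B₁) P₁ ∧ C ∈ 𝒜.join O I)

variable {𝒜}

theorem par_spec {l : Set P} (hl : l ∈ 𝒜.lines) (X : P) :
    𝒜.par l X ∈ 𝒜.lines ∧ X ∈ 𝒜.par l X ∧ Parallel l (𝒜.par l X) := by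
  rw [par, dif_pos hl]
  exact (existsUnique_parallel hl X).choose_spec.1

theorem par_eq {l m : Set P} (hl : l ∈ 𝒜.lines) (hm : m ∈ 𝒜.lines) {X : P} (hX : X ∈ m)
    (h : Parallel l m) : 𝒜.par l X = m :=
  (existsUnique_parallel hl X).unique (par_spec hl X) ⟨hm, hX, h⟩

theorem exists_meet {l m : Set P} (h : ¬ Parallel l m) : ∃ X, X ∈ l ∧ X ∈ m := by
  by_contra hc
  refine h (Or.inr (Set.eq_empty_iff_forall_notMem.mpr fun X hX => hc ⟨X, hX.1, hX.2⟩))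

/-- If `l` and `m` are distinct lines with a common point, a parallel to `l` meets `m`. -/
theorem exists_par_meet {l m : Set P} (hl : l ∈ 𝒜.lines) (hm : m ∈ 𝒜.lines) (hne : l ≠ m)
    {S : P} (hSl : S ∈ l) (hSm : S ∈ m) (X : P) : ∃ Y, Y ∈ 𝒜.par l X ∧ Y ∈ m :=
  exists_meet fun h => hne
    ((Parallel.trans hl (par_spec hl X).1 hm (par_spec hl X).2.2 h).eq hSl hSm)

theorem exists_off_line {l : Set P} (hl : l ∈ 𝒜.lines) : ∃ X, X ∉ l := by
  obtain ⟨X, Y, Z, -, -, -, h⟩ := 𝒜.exists_triangle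
  by_contra hc
  push Not at hc
  exact h ⟨l, hl, hc X, hc Y, hc Z⟩

theorem ne_of_off {l : Set P} {X Y : P} (hX : X ∈ l) (hY : Y ∉ l) : X ≠ Y := by
  rintro rfl
  exact hY hX

theorem join_ne {l : Set P} {X Y : P} (hX : X ∈ l) (hY : Y ∉ l) : 𝒜.join X Y ≠ l := by
  intro h
  exact hY (h ▸ (join_spec (ne_of_off hX hY)).2.2)

/-- Lines joining a point off `l` to two distinct points of `l` are distinct. -/
theorem join_ne_join {l : Set P} (hl : l ∈ 𝒜.lines) {X Y Z : P} (hX : X ∈ l) (hY : Y ∈ l)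
    (hXY : X ≠ Y) (hZ : Z ∉ l) : 𝒜.join X Z ≠ 𝒜.join Y Z := by
  intro h
  have hx := join_spec (𝒜 := 𝒜) (ne_of_off hX hZ)
  have hy := join_spec (𝒜 := 𝒜) (ne_of_off hY hZ)
  exact hZ (line_ext hx.1 hl hXY hx.2.1 (h ▸ hy.2.1) hX hY ▸ hx.2.2)

/-- Two distinct lines through `O` have only `O` in common. -/
theorem eq_of_mem {l m : Set P} (hl : l ∈ 𝒜.lines) (hm : m ∈ 𝒜.lines) (hne : l ≠ m) {O X : P}
    (hOl : O ∈ l) (hOm : O ∈ m) (hXl : X ∈ l) (hXm : X ∈ m) : X = O := by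
  by_contra h
  exact hne (line_ext hl hm h hXl hOl hXm hOm)

section Product

variable {O I B₁ A B : P}

theorem exists_product (hOI : O ≠ I) (hB₁ : B₁ ∉ 𝒜.join O I) (hB : B ∈ 𝒜.join O I) :
    ∃ C, 𝒜.IsProduct O I B₁ A B C := by
  obtain ⟨hl, hO, hI⟩ := join_spec (𝒜 := 𝒜) hOI
  have h1 := join_spec (𝒜 := 𝒜) (ne_of_off hI hB₁)
  have h2 := join_spec (𝒜 := 𝒜) (ne_of_off hO hB₁)
  have h3 := join_spec (𝒜 := 𝒜) (ne_of_off hB hB₁)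
  obtain ⟨P₁, hP⟩ := exists_par_meet h1.1 h2.1 (join_ne_join hl hI hO hOI.symm hB₁) h1.2.2 h2.2.2 A
  obtain ⟨C, hC⟩ := exists_par_meet h3.1 hl (join_ne hB hB₁) h3.2.1 hB P₁
  exact ⟨C, P₁, hP, hC⟩

theorem product_unique (hOI : O ≠ I) (hB₁ : B₁ ∉ 𝒜.join O I) (hB : B ∈ 𝒜.join O I) {C C' : P}
    (h : 𝒜.IsProduct O I B₁ A B C) (h' : 𝒜.IsProduct O I B₁ A B C') : C = C' := by
  obtain ⟨hl, hO, hI⟩ := join_spec (𝒜 := 𝒜) hOI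
  have h1 := join_spec (𝒜 := 𝒜) (ne_of_off hI hB₁)
  have h2 := join_spec (𝒜 := 𝒜) (ne_of_off hO hB₁)
  have h3 := join_spec (𝒜 := 𝒜) (ne_of_off hB hB₁)
  obtain ⟨Q, hQ, hC⟩ := h
  obtain ⟨Q', hQ', hC'⟩ := h'
  have hne : 𝒜.par (𝒜.join I B₁) A ≠ 𝒜.join O B₁ := fun e =>
    join_ne_join hl hI hO hOI.symm hB₁ ((e ▸ (par_spec h1.1 A).2.2).eq h1.2.2 h2.2.2)
  have hQQ : Q = Q' := eq_of_mem (par_spec h1.1 A).1 h2.1 hne hQ'.1 hQ'.2 hQ.1 hQ.2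
  subst hQQ
  have hne' : 𝒜.par (𝒜.join B B₁) Q ≠ 𝒜.join O I := fun e =>
    join_ne hB hB₁ ((e ▸ (par_spec h3.1 Q).2.2).eq h3.2.1 hB)
  exact eq_of_mem (par_spec h3.1 Q).1 hl hne' hC'.1 hC'.2 hC.1 hC.2

/-- Independence of the auxiliary point, for auxiliary points on different lines through `O`. -/
theorem product_change (hD : 𝒜.DesarguesAxiom) (hOI : O ≠ I) {E : P} (hB₁ : B₁ ∉ 𝒜.join O I)
    (hE : E ∉ 𝒜.join O I) (hne : 𝒜.join O B₁ ≠ 𝒜.join O E)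
    (hA : A ∈ 𝒜.join O I) (hB : B ∈ 𝒜.join O I) {C : P}
    (h : 𝒜.IsProduct O I B₁ A B C) : 𝒜.IsProduct O I E A B C := by
  obtain ⟨hl, hO, hI⟩ := join_spec (𝒜 := 𝒜) hOI
  -- the points occurring in the construction, for a given auxiliary point
  have key : ∀ F : P, F ∉ 𝒜.join O I → ∀ Q D : P,
      (Q ∈ 𝒜.par (𝒜.join I F) A ∧ Q ∈ 𝒜.join O F) →
      (D ∈ 𝒜.par (𝒜.join B F) Q ∧ D ∈ 𝒜.join O I) →
      (A = O → Q = O) ∧ (Q = O → A = O) ∧ (Q = O → D = O) ∧ (B = O → D = O) ∧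
        (D = O → Q ≠ O → B = O) := by
    intro F hF Q D hQ hD'
    have h1 := join_spec (𝒜 := 𝒜) (ne_of_off hI hF)
    have h2 := join_spec (𝒜 := 𝒜) (ne_of_off hO hF)
    have h3 := join_spec (𝒜 := 𝒜) (ne_of_off hB hF)
    have p1 := par_spec h1.1 A
    have p3 := par_spec h3.1 Q
    refine ⟨?_, ?_, ?_, ?_, ?_⟩
    · rintro rfl
      refine eq_of_mem p1.1 h2.1 (fun e => ?_) p1.2.1 h2.2.1 hQ.1 hQ.2
      exact join_ne_join hl hI hO hOI.symm hF ((e ▸ p1.2.2).eq h1.2.2 h2.2.2)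
    · rintro rfl
      refine eq_of_mem p1.1 hl (fun e => ?_) hQ.1 hO p1.2.1 hA
      exact join_ne hI hF ((e ▸ p1.2.2).eq h1.2.1 hI)
    · rintro rfl
      refine eq_of_mem p3.1 hl (fun e => ?_) p3.2.1 hO hD'.1 hD'.2
      exact join_ne hB hF ((e ▸ p3.2.2).eq h3.2.1 hB)
    · rintro rfl
      have e := par_eq h3.1 h2.1 hQ.2 (Or.inl rfl)
      rw [e] at hD'
      exact eq_of_mem h2.1 hl (join_ne hO hF) h2.2.1 hO hD'.1 hD'.2
    · rintro rfl hQO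
      have e : 𝒜.par (𝒜.join B F) Q = 𝒜.join D F :=
        line_ext p3.1 h2.1 hQO p3.2.1 hD'.1 hQ.2 h2.2.1
      have e2 : 𝒜.join B F = 𝒜.join D F := (e ▸ p3.2.2).eq h3.2.2 h2.2.2
      by_contra hBO
      exact join_ne_join hl hB hO hBO hF e2
  obtain ⟨Q, hQ, hC⟩ := h
  obtain ⟨C', Q', hQ', hC'⟩ := exists_product (𝒜 := 𝒜) (A := A) hOI hE hB
  have k := key B₁ hB₁ Q C hQ hC
  have k' := key E hE Q' C' hQ' hC'
  refine ⟨Q', hQ', ?_, hC.2⟩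
  by_cases hAO : A = O
  · rw [k.2.2.1 (k.1 hAO), ← k'.2.2.1 (k'.1 hAO)]
    exact hC'.1
  by_cases hBO : B = O
  · rw [k.2.2.2.1 hBO, ← k'.2.2.2.1 hBO]
    exact hC'.1
  have hQO : Q ≠ O := fun e => hAO (k.2.1 e)
  have hQO' : Q' ≠ O := fun e => hAO (k'.2.1 e)
  have hCO : C ≠ O := fun e => hBO (k.2.2.2.2 e hQO)
  have a1 := join_spec (𝒜 := 𝒜) (ne_of_off hI hB₁)
  have a2 := join_spec (𝒜 := 𝒜) (ne_of_off hO hB₁)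
  have a3 := join_spec (𝒜 := 𝒜) (ne_of_off hB hB₁)
  have e1 := join_spec (𝒜 := 𝒜) (ne_of_off hI hE)
  have e2 := join_spec (𝒜 := 𝒜) (ne_of_off hO hE)
  have e3 := join_spec (𝒜 := 𝒜) (ne_of_off hB hE)
  have nB : 𝒜.join O B₁ ≠ 𝒜.join O I := join_ne hO hB₁
  have nE : 𝒜.join O E ≠ 𝒜.join O I := join_ne hO hE
  -- a point of another line through `O`, other than `O`, is off the line `OI`
  have off : ∀ F, F ∉ 𝒜.join O I → ∀ X ∈ 𝒜.join O F, X ≠ O → X ∉ 𝒜.join O I := by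
    intro F hF X hX hXO hXl
    have h2 := join_spec (𝒜 := 𝒜) (ne_of_off hO hF)
    exact hXO (eq_of_mem h2.1 hl (join_ne hO hF) h2.2.1 hO hX hXl)
  have hQl := off B₁ hB₁ Q hQ.2 hQO
  have hQl' := off E hE Q' hQ'.2 hQO'
  have pA : 𝒜.join A Q = 𝒜.par (𝒜.join I B₁) A :=
    join_eq (ne_of_off hA hQl) (par_spec a1.1 A).1 (par_spec a1.1 A).2.1 hQ.1
  have pA' : 𝒜.join A Q' = 𝒜.par (𝒜.join I E) A :=
    join_eq (ne_of_off hA hQl') (par_spec e1.1 A).1 (par_spec e1.1 A).2.1 hQ'.1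
  have pC : 𝒜.join C Q = 𝒜.par (𝒜.join B B₁) Q :=
    join_eq (ne_of_off hC.2 hQl) (par_spec a3.1 Q).1 hC.1 (par_spec a3.1 Q).2.1
  have hB₁O : B₁ ≠ O := (ne_of_off hO hB₁).symm
  have hEO : E ≠ O := (ne_of_off hO hE).symm
  have d1 := hD _ a2.1 _ hl _ e2.1 nB nE.symm hne B₁ a2.2.2 Q hQ.2 I hI A hA E e2.2.2 Q' hQ'.2
    (Or.inr ⟨O, ⟨a2.2.1, hO, e2.2.1⟩, hB₁O, hQO, hOI.symm, hAO, hEO, hQO'⟩)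
    (by rw [join_comm B₁ I, join_comm Q A, pA]; exact (par_spec a1.1 A).2.2)
    (by rw [pA']; exact (par_spec e1.1 A).2.2)
  have d2 := hD _ hl _ a2.1 _ e2.1 nB.symm hne nE.symm B hB C hC.2 B₁ a2.2.2 Q hQ.2 E e2.2.2
    Q' hQ'.2
    (Or.inr ⟨O, ⟨hO, a2.2.1, e2.2.1⟩, hBO, hCO, hB₁O, hQO, hEO, hQO'⟩)
    (by rw [pC]; exact (par_spec a3.1 Q).2.2) d1
  have s := join_spec (𝒜 := 𝒜) (ne_of_off hC.2 hQl')
  rw [par_eq e3.1 s.1 s.2.2 d2]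
  exact s.2.1

/-- The multiplication algorithm yields exactly one point of the line `OI`, the same one for every
auxiliary point. -/
theorem existsUnique_product (hD : 𝒜.DesarguesAxiom) (hOI : O ≠ I) (hA : A ∈ 𝒜.join O I)
    (hB : B ∈ 𝒜.join O I) :
    ∃! C : P, C ∈ 𝒜.join O I ∧ ∀ B₁, B₁ ∉ 𝒜.join O I → 𝒜.IsProduct O I B₁ A B C := by
  obtain ⟨hl, hO, hI⟩ := join_spec (𝒜 := 𝒜) hOI
  obtain ⟨E, hE⟩ := exists_off_line hl
  obtain ⟨C, hC⟩ := exists_product (𝒜 := 𝒜) (A := A) hOI hE hB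
  refine ⟨C, ⟨hC.choose_spec.2.2, fun B₁ hB₁ => ?_⟩,
    fun C' hC' => product_unique hOI hE hB (hC'.2 E hE) hC⟩
  by_cases hne : 𝒜.join O E = 𝒜.join O B₁
  · -- pass through an auxiliary point `F` on a third line through `O`
    have e1 := join_spec (𝒜 := 𝒜) (ne_of_off hO hE)
    have hIE : I ∉ 𝒜.join O E := fun h => hOI
      (eq_of_mem e1.1 hl (join_ne hO hE) e1.2.1 hO h hI).symm
    obtain ⟨F, hF1, hF2⟩ := exists_par_meet hl (par_spec e1.1 I).1
      (fun e => hIE (by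
        have := (par_spec e1.1 I).2.2
        rw [← e] at this
        rw [this.eq e1.2.1 hO]; exact hI)) hI (par_spec e1.1 I).2.1 E
    have hFl : F ∉ 𝒜.join O I := fun h => hE (by
      rw [(par_spec hl E).2.2.eq h hF1]; exact (par_spec hl E).2.1)
    have hFE : F ∉ 𝒜.join O E := fun h => hIE (by
      rw [(par_spec e1.1 I).2.2.eq h hF2]; exact (par_spec e1.1 I).2.1)
    have f1 := join_spec (𝒜 := 𝒜) (ne_of_off hO hFl)
    have hEF : 𝒜.join O E ≠ 𝒜.join O F := fun e => hFE (by rw [e]; exact f1.2.2)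
    exact product_change hD hOI hFl hB₁ (fun e => hEF (hne.trans e.symm)) hA hB
      (product_change hD hOI hE hFl hEF hA hB hC)
  · exact product_change hD hOI hE hB₁ hne hA hB hC

end Product

end AffinePlane

/-- A Desargues affine plane: an affine plane satisfying Desargues' axiom. -/
structure DesarguesAffinePlane (P : Type*) extends AffinePlane P where
  desargues : toAffinePlane.DesarguesAxiom

namespace DesarguesAffinePlane

open AffinePlane

variable {P : Type*} (𝒟 : DesarguesAffinePlane P) {O I : P} (hOI : O ≠ I)

/-- The point `O` of the line `OI`. -/
noncomputable def zeroPt : 𝒟.join O I := ⟨O, (join_spec hOI).2.1⟩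

/-- The point `I` of the line `OI`. -/
noncomputable def unitPt : 𝒟.join O I := ⟨I, (join_spec hOI).2.2⟩

/-- The product `A · B` of two points of the line `OI`: the point that the multiplication algorithm
yields, whatever the auxiliary point. -/
noncomputable def mul (A B : 𝒟.join O I) : 𝒟.join O I :=
  ⟨(existsUnique_product 𝒟.desargues hOI A.2 B.2).choose,
    (existsUnique_product 𝒟.desargues hOI A.2 B.2).choose_spec.1.1⟩

open Classical in
/-- The inverse `B⁻¹` of a point of the line `OI`: the point `X` with `X · B = B · X = I`
(by convention `O` if there is none, as for `B = O`). -/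
noncomputable def inv (B : 𝒟.join O I) : 𝒟.join O I :=
  if h : ∃ X, 𝒟.mul hOI X B = 𝒟.unitPt hOI ∧ 𝒟.mul hOI B X = 𝒟.unitPt hOI then h.choose
  else 𝒟.zeroPt hOI

/-- The ratio `r(A : B) = B⁻¹ · A` of two points of the line `OI`. -/
noncomputable def ratio (A B : 𝒟.join O I) : 𝒟.join O I := 𝒟.mul hOI (𝒟.inv hOI B) A

/-- The ratio map `r_B`, `X ↦ r(X : B)`. -/
noncomputable def ratioMap (B : 𝒟.join O I) : 𝒟.join O I → 𝒟.join O I :=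
  fun X => 𝒟.ratio hOI X B

end DesarguesAffinePlane

/-! ### Identities for the multiplication algorithm -/

namespace AffinePlane

variable {P : Type*} {𝒜 : AffinePlane P} {O I B₁ A B : P}

/-! Once the multiplication is associative with unit `I` and every point other than `O` has a
two-sided inverse, left multiplications by `B` and `B⁻¹` undo each other. The weight lies on
associativity, `IsProduct.assoc`. Desargues' axiom enters only through independence of the auxiliary
point, which allows different auxiliary points for different products. If `Q` is the intermediate
point of `B · C` built from `B₁`, then `OQ = OB₁`, `BQ ∥ IB₁`, and `DQ ∥ CB₁` for `D = B · C`. With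
auxiliary point `Q`, the products `A · B` and `A · D` share an intermediate point `R`, and the same
figure read from `B₁` is the construction of `(A · B) · C`. Right inverses come from running the
construction backwards (`exists_isProduct_unit`); associativity makes them two-sided. -/

theorem par_congr {l m : Set P} (hl : l ∈ 𝒜.lines) (hm : m ∈ 𝒜.lines) (h : Parallel l m) (X : P) :
    𝒜.par l X = 𝒜.par m X := by
  have hp := par_spec hm X
  exact par_eq hl hp.1 hp.2.1 (Parallel.trans hl hm hp.1 h hp.2.2)

theorem par_eq_self {l : Set P} (hl : l ∈ 𝒜.lines) {X : P} (hX : X ∈ l) : 𝒜.par l X = l :=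
  par_eq hl hl hX (Or.inl rfl)

/-- The intermediate point of the multiplication algorithm is determined. -/
theorem product_mid_unique (hOI : O ≠ I) (hB₁ : B₁ ∉ 𝒜.join O I) {Q Q' : P}
    (hQ : Q ∈ 𝒜.par (𝒜.join I B₁) A) (hQO : Q ∈ 𝒜.join O B₁)
    (hQ' : Q' ∈ 𝒜.par (𝒜.join I B₁) A) (hQO' : Q' ∈ 𝒜.join O B₁) : Q = Q' := by
  obtain ⟨hl, hO, hI⟩ := join_spec (𝒜 := 𝒜) hOI
  have h1 := join_spec (𝒜 := 𝒜) (ne_of_off hI hB₁)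
  have h2 := join_spec (𝒜 := 𝒜) (ne_of_off hO hB₁)
  have hne : 𝒜.par (𝒜.join I B₁) A ≠ 𝒜.join O B₁ := fun e =>
    join_ne_join hl hI hO hOI.symm hB₁ ((e ▸ (par_spec h1.1 A).2.2).eq h1.2.2 h2.2.2)
  exact eq_of_mem (par_spec h1.1 A).1 h2.1 hne hQ' hQO' hQ hQO

/-- The intermediate point of the multiplication algorithm is off the line `OI` when the first
factor is not `O`. -/
theorem product_mid_off (hOI : O ≠ I) (hB₁ : B₁ ∉ 𝒜.join O I) (hA : A ∈ 𝒜.join O I) (hAO : A ≠ O)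
    {Q : P} (hQ : Q ∈ 𝒜.par (𝒜.join I B₁) A) (hQO : Q ∈ 𝒜.join O B₁) : Q ∉ 𝒜.join O I := by
  obtain ⟨hl, hO, hI⟩ := join_spec (𝒜 := 𝒜) hOI
  have h1 := join_spec (𝒜 := 𝒜) (ne_of_off hI hB₁)
  have h2 := join_spec (𝒜 := 𝒜) (ne_of_off hO hB₁)
  have p := par_spec h1.1 A
  intro hQl
  obtain rfl : Q = O := eq_of_mem h2.1 hl (join_ne hO hB₁) h2.2.1 hO hQO hQl
  -- If `Q = O`, the parallel to `IB₁` through `A` is `OI`, which forces `B₁` onto `OI`.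
  have e := line_ext p.1 hl hAO p.2.1 hQ hA hO
  exact join_ne hI hB₁ ((e ▸ p.2.2).eq h1.2.1 hI)

theorem isProduct_unit_left (hOI : O ≠ I) (hB₁ : B₁ ∉ 𝒜.join O I) (hB : B ∈ 𝒜.join O I) :
    𝒜.IsProduct O I B₁ I B B := by
  obtain ⟨-, hO, hI⟩ := join_spec (𝒜 := 𝒜) hOI
  have h1 := join_spec (𝒜 := 𝒜) (ne_of_off hI hB₁)
  have h2 := join_spec (𝒜 := 𝒜) (ne_of_off hO hB₁)
  have h3 := join_spec (𝒜 := 𝒜) (ne_of_off hB hB₁)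
  refine ⟨B₁, ⟨?_, h2.2.2⟩, ?_, hB⟩
  · rw [par_eq_self h1.1 h1.2.1]; exact h1.2.2
  · rw [par_eq_self h3.1 h3.2.2]; exact h3.2.1

/-- With second factor `I` both parallels of the construction have the direction `IB₁` and pass
through `Q`, so they coincide. -/
theorem isProduct_unit_right (hOI : O ≠ I) (hB₁ : B₁ ∉ 𝒜.join O I) (hA : A ∈ 𝒜.join O I) :
    𝒜.IsProduct O I B₁ A I A := by
  obtain ⟨-, hO, hI⟩ := join_spec (𝒜 := 𝒜) hOI
  have h1 := join_spec (𝒜 := 𝒜) (ne_of_off hI hB₁)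
  obtain ⟨-, Q, hQ, -⟩ := exists_product (𝒜 := 𝒜) (A := A) hOI hB₁ hI
  have p := par_spec h1.1 A
  refine ⟨Q, hQ, ?_, hA⟩
  rw [par_eq h1.1 p.1 hQ.1 p.2.2]
  exact p.2.1

theorem isProduct_zero_right (hOI : O ≠ I) (hB₁ : B₁ ∉ 𝒜.join O I) :
    𝒜.IsProduct O I B₁ A O O := by
  obtain ⟨-, hO, hI⟩ := join_spec (𝒜 := 𝒜) hOI
  have h2 := join_spec (𝒜 := 𝒜) (ne_of_off hO hB₁)
  obtain ⟨-, Q, hQ, -⟩ := exists_product (𝒜 := 𝒜) (A := A) hOI hB₁ hO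
  refine ⟨Q, hQ, ?_, hO⟩
  rw [par_eq_self h2.1 hQ.2]
  exact h2.2.1

/-- The last step is reversed: the direction `IQ` is prescribed, and `X` is where the parallel to it
through `B₁` meets `OI`. -/
theorem exists_isProduct_unit (hOI : O ≠ I) (hB₁ : B₁ ∉ 𝒜.join O I) (hA : A ∈ 𝒜.join O I)
    (hAO : A ≠ O) : ∃ X ∈ 𝒜.join O I, 𝒜.IsProduct O I B₁ A X I := by
  obtain ⟨hl, -, hI⟩ := join_spec (𝒜 := 𝒜) hOI
  obtain ⟨-, Q, hQ, -⟩ := exists_product (𝒜 := 𝒜) (A := A) hOI hB₁ hI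
  have hQl := product_mid_off hOI hB₁ hA hAO hQ.1 hQ.2
  have h := join_spec (𝒜 := 𝒜) (ne_of_off hI hQl)
  obtain ⟨X, hX, hXl⟩ := exists_par_meet h.1 hl (join_ne hI hQl) h.2.1 hI B₁
  have p := par_spec h.1 B₁
  have e : 𝒜.join X B₁ = 𝒜.par (𝒜.join I Q) B₁ := join_eq (ne_of_off hXl hB₁) p.1 hX p.2.1
  refine ⟨X, hXl, Q, hQ, ?_, hI⟩
  rw [e, par_eq p.1 h.1 h.2.2 p.2.2.symm]
  exact h.2.1

/-- Associativity of the multiplication algorithm: `A · B` and `A · (B · C)` are constructed with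
the intermediate point `Q` of `B · C` as auxiliary point. -/
theorem IsProduct.assoc (hOI : O ≠ I) (hB₁ : B₁ ∉ 𝒜.join O I) (hB : B ∈ 𝒜.join O I) (hBO : B ≠ O)
    {C D E F : P} (hC : C ∈ 𝒜.join O I) (hBC : 𝒜.IsProduct O I B₁ B C D)
    (hAB : ∀ Q, Q ∉ 𝒜.join O I → 𝒜.IsProduct O I Q A B E)
    (hAD : ∀ Q, Q ∉ 𝒜.join O I → 𝒜.IsProduct O I Q A D F) :
    𝒜.IsProduct O I B₁ E C F := by
  obtain ⟨hl, hO, hI⟩ := join_spec (𝒜 := 𝒜) hOI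
  have h1 := join_spec (𝒜 := 𝒜) (ne_of_off hI hB₁)
  have h2 := join_spec (𝒜 := 𝒜) (ne_of_off hO hB₁)
  have h3 := join_spec (𝒜 := 𝒜) (ne_of_off hC hB₁)
  obtain ⟨Q, ⟨hQ, hQO⟩, hD, hDl⟩ := hBC
  -- This is where `B ≠ O` matters: `Q` must be off `OI` to serve as an auxiliary point.
  have hQl := product_mid_off hOI hB₁ hB hBO hQ hQO
  obtain ⟨R, ⟨hR, hRO⟩, hE, -⟩ := hAB Q hQl
  obtain ⟨R', ⟨hR', hRO'⟩, hF, hFl⟩ := hAD Q hQl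
  obtain rfl := product_mid_unique hOI hQl hR hRO hR' hRO'
  rw [join_eq (ne_of_off hO hQl) h2.1 h2.2.1 hQO] at hRO
  have pB := par_spec h1.1 B
  have pD := par_spec h3.1 Q
  rw [join_eq (ne_of_off hB hQl) pB.1 pB.2.1 hQ, ← par_congr h1.1 pB.1 pB.2.2] at hE
  rw [join_eq (ne_of_off hDl hQl) pD.1 hD pD.2.1, ← par_congr h3.1 pD.1 pD.2.2] at hF
  have pR := par_spec h1.1 R
  -- Since `RE ∥ IB₁` and `R` lies on `OB₁`, `R` is the intermediate point of `E · C` built from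
  -- `B₁`.
  refine ⟨R, ⟨?_, hRO⟩, hF, hFl⟩
  rw [par_eq h1.1 pR.1 hE pR.2.2]
  exact pR.2.1

end AffinePlane

/-! ### Algebra of the points of the line `OI` -/

namespace DesarguesAffinePlane

open AffinePlane

variable {P : Type*} (𝒟 : DesarguesAffinePlane P) {O I : P} (hOI : O ≠ I)

theorem isProduct_mul (A B : 𝒟.join O I) {B₁ : P} (hB₁ : B₁ ∉ 𝒟.join O I) :
    𝒟.IsProduct O I B₁ A B (𝒟.mul hOI A B) :=
  (existsUnique_product 𝒟.desargues hOI A.2 B.2).choose_spec.1.2 B₁ hB₁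

theorem mul_eq_of_isProduct {A B C : 𝒟.join O I} {B₁ : P} (hB₁ : B₁ ∉ 𝒟.join O I)
    (h : 𝒟.IsProduct O I B₁ A B C) : 𝒟.mul hOI A B = C :=
  Subtype.ext (product_unique hOI hB₁ B.2 (𝒟.isProduct_mul hOI A B hB₁) h)

theorem unit_mul (A : 𝒟.join O I) : 𝒟.mul hOI (𝒟.unitPt hOI) A = A := by
  obtain ⟨B₁, hB₁⟩ := exists_off_line (join_spec (𝒜 := 𝒟.toAffinePlane) hOI).1
  exact 𝒟.mul_eq_of_isProduct hOI hB₁ (isProduct_unit_left hOI hB₁ A.2)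

theorem mul_unit (A : 𝒟.join O I) : 𝒟.mul hOI A (𝒟.unitPt hOI) = A := by
  obtain ⟨B₁, hB₁⟩ := exists_off_line (join_spec (𝒜 := 𝒟.toAffinePlane) hOI).1
  exact 𝒟.mul_eq_of_isProduct hOI hB₁ (isProduct_unit_right hOI hB₁ A.2)

theorem mul_zero (A : 𝒟.join O I) : 𝒟.mul hOI A (𝒟.zeroPt hOI) = 𝒟.zeroPt hOI := by
  obtain ⟨B₁, hB₁⟩ := exists_off_line (join_spec (𝒜 := 𝒟.toAffinePlane) hOI).1
  exact 𝒟.mul_eq_of_isProduct hOI hB₁ (isProduct_zero_right hOI hB₁)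

theorem coe_ne_of_ne_zeroPt {A : 𝒟.join O I} (hA : A ≠ 𝒟.zeroPt hOI) : (A : P) ≠ O :=
  fun h => hA (Subtype.ext h)

/-- Only the middle factor has to differ from `O`, so the outer ones may be arbitrary points of the
line. -/
theorem mul_assoc_of_ne_zeroPt (A : 𝒟.join O I) {B : 𝒟.join O I} (hB : B ≠ 𝒟.zeroPt hOI)
    (C : 𝒟.join O I) :
    𝒟.mul hOI (𝒟.mul hOI A B) C = 𝒟.mul hOI A (𝒟.mul hOI B C) := by
  obtain ⟨B₁, hB₁⟩ := exists_off_line (join_spec (𝒜 := 𝒟.toAffinePlane) hOI).1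
  exact 𝒟.mul_eq_of_isProduct hOI hB₁
    (IsProduct.assoc hOI hB₁ B.2 (𝒟.coe_ne_of_ne_zeroPt hOI hB) C.2 (𝒟.isProduct_mul hOI B C hB₁)
      (fun _ hQ => 𝒟.isProduct_mul hOI A B hQ)
      (fun _ hQ => 𝒟.isProduct_mul hOI A (𝒟.mul hOI B C) hQ))

/-- A point other than `O` has a right inverse, which is not `O`. -/
theorem exists_right_inverse {B : 𝒟.join O I} (hB : B ≠ 𝒟.zeroPt hOI) :
    ∃ X, X ≠ 𝒟.zeroPt hOI ∧ 𝒟.mul hOI B X = 𝒟.unitPt hOI := by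
  obtain ⟨B₁, hB₁⟩ := exists_off_line (join_spec (𝒜 := 𝒟.toAffinePlane) hOI).1
  obtain ⟨X, hX, h⟩ := exists_isProduct_unit hOI hB₁ B.2 (𝒟.coe_ne_of_ne_zeroPt hOI hB)
  have hBX : 𝒟.mul hOI B ⟨X, hX⟩ = 𝒟.unitPt hOI := 𝒟.mul_eq_of_isProduct hOI hB₁ h
  refine ⟨⟨X, hX⟩, fun e => ?_, hBX⟩
  rw [e, mul_zero] at hBX
  exact hOI (congrArg Subtype.val hBX)

theorem exists_inverse {B : 𝒟.join O I} (hB : B ≠ 𝒟.zeroPt hOI) :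
    ∃ X, 𝒟.mul hOI X B = 𝒟.unitPt hOI ∧ 𝒟.mul hOI B X = 𝒟.unitPt hOI := by
  obtain ⟨X, hX, hBX⟩ := 𝒟.exists_right_inverse hOI hB
  obtain ⟨Y, -, hXY⟩ := 𝒟.exists_right_inverse hOI hX
  have e := 𝒟.mul_assoc_of_ne_zeroPt hOI B hX Y
  -- Evaluating `(B · X) · Y = B · (X · Y)` gives `Y = B`, so the right inverse `X` of `B` is also a
  -- left inverse.
  rw [hBX, hXY, unit_mul, mul_unit] at e
  exact ⟨X, e ▸ hXY, hBX⟩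

theorem inv_spec {B : 𝒟.join O I} (hB : B ≠ 𝒟.zeroPt hOI) :
    𝒟.mul hOI (𝒟.inv hOI B) B = 𝒟.unitPt hOI ∧
      𝒟.mul hOI B (𝒟.inv hOI B) = 𝒟.unitPt hOI := by
  have h := 𝒟.exists_inverse hOI hB
  rw [inv, dif_pos h]
  exact h.choose_spec

theorem inv_ne_zeroPt {B : 𝒟.join O I} (hB : B ≠ 𝒟.zeroPt hOI) :
    𝒟.inv hOI B ≠ 𝒟.zeroPt hOI := by
  intro e
  have h := (𝒟.inv_spec hOI hB).2
  rw [e, mul_zero] at h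
  exact hOI (congrArg Subtype.val h)

end DesarguesAffinePlane

theorem mainTheorem4 {P : Type*} (𝒟 : DesarguesAffinePlane P) {O I : P} (hOI : O ≠ I)
    (B : 𝒟.join O I) (hB : B ≠ 𝒟.zeroPt hOI) :
    (𝒟.mul hOI (𝒟.inv hOI B) B = 𝒟.unitPt hOI ∧ 𝒟.mul hOI B (𝒟.inv hOI B) = 𝒟.unitPt hOI) ∧
      Function.Bijective (𝒟.ratioMap hOI B) ∧
      Function.LeftInverse (fun R => 𝒟.mul hOI B R) (𝒟.ratioMap hOI B) ∧
      Function.RightInverse (fun R => 𝒟.mul hOI B R) (𝒟.ratioMap hOI B) := by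
  have hinv := 𝒟.inv_spec hOI hB
  have hl : Function.LeftInverse (fun R => 𝒟.mul hOI B R) (𝒟.ratioMap hOI B) := fun X => by
    change 𝒟.mul hOI B (𝒟.mul hOI (𝒟.inv hOI B) X) = X
    -- The middle factor is now `B⁻¹`, so it is `B⁻¹ ≠ O` that permits reassociating.
    rw [← 𝒟.mul_assoc_of_ne_zeroPt hOI B (𝒟.inv_ne_zeroPt hOI hB), hinv.2, 𝒟.unit_mul]
  have hr : Function.RightInverse (fun R => 𝒟.mul hOI B R) (𝒟.ratioMap hOI B) := fun R => by
    change 𝒟.mul hOI (𝒟.inv hOI B) (𝒟.mul hOI B R) = R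
    rw [← 𝒟.mul_assoc_of_ne_zeroPt hOI _ hB, hinv.1, 𝒟.unit_mul]
  exact ⟨hinv, ⟨hl.injective, hr.surjective⟩, hl, hr⟩
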